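/- Let $G$ be a finite simple digraph with at least one edge which is a planar $st$-digraph: $G$ is acyclic, it has exactly one source $s$ (vertex of in-degree $0$) and exactly one sink $t$ (vertex of out-degree $0$), and it comes with an embedding in the plane (faces and external face fixed) in which both $s$ and $t$ lie on the boundary of the external face. Suppose that $G$ is triangulated, i.e. every interior (non-external) face is bounded by exactly $3$ vertices and $3$ edges; the external face may be arbitrary. A rhombus in $G$ is an embedded subgraph consisting of four distinct vertices $s',t',a,b$ and the five edges $(s',t')$, $(s',a)$, $(a,t')$, $(s',b)$, $(b,t')$, such that the median $(s',t')$ lies in the interior of the closed curve formed by the other four edges (other vertices and edges of $G$ may also lie in that interior). A facial rhombus is a rhombus for which the two faces of $G$ on the two sides of the median are interior triangular faces with vertices $s',t',a$ and $s',t',b$, and for which $G$ has no directed path from $a$ to $b$ and none from $b$ to $a$. Then the following are equivalent: (i) $G$ has a Hamiltonian path, i.e. a directed path visiting every vertex exactly once; (ii) $G$ contains no rhombus; (iii) $G$ contains no facial rhombus. -/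

import Mathlib

/-- A combinatorial embedding of a simple graph `H` (a rotation system): `rot` permutes the darts
(oriented edges) of `H`, and its cycles are exactly the sets of darts with a common origin, so that
it lists the darts leaving each vertex in their cyclic order around that vertex. -/
structure RotationSystem {V : Type*} (H : SimpleGraph V) where
  rot : Equiv.Perm H.Dart
  rot_fst : ∀ d, (rot d).fst = d.fst
  rot_sameCycle : ∀ d d' : H.Dart, d.fst = d'.fst → rot.SameCycle d d'

namespace RotationSystem

variable {V : Type*} {H : SimpleGraph V}

/-- Dart reversal as a permutation. -/
def symmPerm (H : SimpleGraph V) : Equiv.Perm H.Dart where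
  toFun d := d.symm
  invFun d := d.symm
  left_inv d := d.symm_symm
  right_inv d := d.symm_symm

/-- The face-tracing permutation: walk along a dart, then take the dart following its reversal
in the rotation at the vertex that has been reached. -/
def faceNext (M : RotationSystem H) : Equiv.Perm H.Dart :=
  (symmPerm H).trans M.rot

/-- The faces of the embedding: the orbits of the face-tracing permutation, i.e. the closed
walks that bound the faces. -/
def Face (M : RotationSystem H) : Type _ :=
  Quotient (Equiv.Perm.SameCycle.setoid M.faceNext)

/-- The face on a fixed side of the dart `d`; `M.face d` and `M.face d.symm` are the faces on the
two sides of the edge of `d`. -/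
def face (M : RotationSystem H) (d : H.Dart) : M.Face :=
  Quotient.mk (Equiv.Perm.SameCycle.setoid M.faceNext) d

/-- The vertices on the boundary of a face. -/
def faceVerts (M : RotationSystem H) (f : M.Face) : Set V :=
  {v | ∃ d : H.Dart, M.face d = f ∧ d.fst = v}

/-- A face is a triangle if its boundary walk has length three (in a simple graph such a closed
walk runs around three distinct vertices and three distinct edges). -/
def IsTriangle (M : RotationSystem H) (f : M.Face) : Prop :=
  {d : H.Dart | M.face d = f}.ncard = 3

end RotationSystem

/-- An embedding in the plane of a finite connected graph with at least one edge: a rotation system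
of genus zero (Euler's formula) together with the choice of the external face. -/
structure PlaneEmbedding {V : Type*} (H : SimpleGraph V) extends RotationSystem H where
  connected : H.Connected
  euler : Nat.card V + Nat.card toRotationSystem.Face = H.edgeSet.ncard + 2
  outer : toRotationSystem.Face

/-- All interior faces are triangles. -/
def PlaneEmbedding.IsTriangulated {V : Type*} {H : SimpleGraph V} (M : PlaneEmbedding H) : Prop :=
  ∀ f : M.Face, f ≠ M.outer → M.IsTriangle f

/-- `G`, with the plane embedding `M` of its underlying undirected graph, is a planar `st`-digraph:
it is acyclic, `s` is its only vertex of in-degree zero, `t` is its only vertex of out-degree zero,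
and both lie on the boundary of the external face. -/
structure IsPlanarSTDigraph {V : Type*} (G : Digraph V)
    (M : PlaneEmbedding G.toSimpleGraphInclusive) (s t : V) : Prop where
  acyclic : ∀ v, ¬ Relation.TransGen G.Adj v v
  source : ∀ v, (∀ u, ¬ G.Adj u v) ↔ v = s
  sink : ∀ v, (∀ u, ¬ G.Adj v u) ↔ v = t
  source_outer : s ∈ M.faceVerts M.outer
  sink_outer : t ∈ M.faceVerts M.outer

/-- `G` has a Hamiltonian path: a directed path that visits every vertex exactly once. -/
def HasHamiltonianPath {V : Type*} (G : Digraph V) : Prop :=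
  ∃ l : List V, l.IsChain G.Adj ∧ l.Nodup ∧ ∀ v, v ∈ l

/-- The edges of a rhombus with source `u`, sink `v`, side vertices `a`, `b` and median `(u, v)`
are present in `G`. -/
structure IsRhombusGraph {V : Type*} (G : Digraph V) (u v a b : V) : Prop where
  ne : a ≠ b
  median : G.Adj u v
  u_a : G.Adj u a
  a_v : G.Adj a v
  u_b : G.Adj u b
  b_v : G.Adj b v

/-- The vertices `u, v, a, b` span a rhombus in the embedded digraph `G`: its five edges are
present, and the median lies in the interior of the closed curve `u a v b`. The interior of this
curve is the set `S` of faces that does not contain the external face and for which the edges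
having exactly one of their two sides in `S` are exactly the four edges of the curve. -/
def IsRhombus {V : Type*} (G : Digraph V)
    (M : PlaneEmbedding G.toSimpleGraphInclusive) (u v a b : V) : Prop :=
  IsRhombusGraph G u v a b ∧
  ∃ S : Set M.Face, M.outer ∉ S ∧
    (∀ d : G.toSimpleGraphInclusive.Dart,
      ¬ (M.face d ∈ S ↔ M.face d.symm ∈ S) ↔
        d.edge = s(u, a) ∨ d.edge = s(a, v) ∨ d.edge = s(u, b) ∨ d.edge = s(b, v)) ∧
    ∀ d : G.toSimpleGraphInclusive.Dart, d.edge = s(u, v) → M.face d ∈ S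

/-- The vertices `u, v, a, b` form a rhombus consisting of two faces: the two faces at the median
`(u, v)` are interior triangular faces with vertices `u, v, a` and `u, v, b`, and no directed path
joins `a` and `b` in either direction. -/
def IsFacialRhombus {V : Type*} (G : Digraph V)
    (M : PlaneEmbedding G.toSimpleGraphInclusive) (u v a b : V) : Prop :=
  IsRhombusGraph G u v a b ∧
  (∃ d : G.toSimpleGraphInclusive.Dart, d.edge = s(u, v) ∧
    M.face d ≠ M.outer ∧ M.face d.symm ≠ M.outer ∧
    M.IsTriangle (M.face d) ∧ M.IsTriangle (M.face d.symm) ∧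
    M.faceVerts (M.face d) = {u, v, a} ∧ M.faceVerts (M.face d.symm) = {u, v, b}) ∧
  ¬ Relation.ReflTransGen G.Adj a b ∧ ¬ Relation.ReflTransGen G.Adj b a

/-!
The theorem follows from two arguments, one topological and one local.

*No directed path joins the side vertices `a`, `b` of a rhombus* (`IsRhombus.not_reflTransGen`). A
path from `a` to `b` together with the edges at `u` is a closed curve, hence bounds a set of faces
without the external one; adding the interior of the rhombus modulo two gives the set bounded by the
path and the edges at `v`. One of the two sets contains the faces at the median. In the first case
`v` is enclosed by the path and `u`, in the second `u` is enclosed by the path and `v`. Since `v`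
reaches the sink and `u` is reached from the source, and both lie on the external face, a directed
path has to meet the enclosing curve, which contradicts acyclicity. The Jordan curve theorem needed
here is `PlaneEmbedding.exists_faceBoundary_eq`: over the field with two elements, Euler's
formula makes the space of boundaries of face sets as large as the cycle space.
A Hamiltonian path makes any two vertices comparable, so it excludes rhombi; and a facial rhombus is
a rhombus, whose interior consists of its two faces.

*Without facial rhombi every vertex `v ≠ t` has an out-neighbour that reaches all its other
out-neighbours* (`IsPlanarSTDigraph.exists_adj_forall_adj_reflTransGen`), and following these
out-neighbours from `s` gives a Hamiltonian path. Every face has a corner whose two edges leave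
their common vertex and one whose two edges enter it, and every vertex other than `s`, `t` has at
least two corners between an incoming and an outgoing edge. By Euler's formula there are no further
corners (`IsPlanarSTDigraph.corners_unique`). Hence the outgoing edges at `v` form a linear sequence
whose consecutive members bound interior triangles, so that consecutive heads are adjacent. If an
edge of this sequence joins the source to the sink in the triangles on both of its sides, it is the
median of a rhombus made of two faces, which by the first argument is facial. Otherwise the edges
between consecutive heads point away from a single head.
-/

open Relation

/-! ### Faces of a rotation system -/

namespace RotationSystem

variable {V : Type*} {H : SimpleGraph V}

/-- The face-tracing permutation takes the reversal of `d` to the dart after `d`. -/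
theorem faceNext_symm (M : RotationSystem H) (d : H.Dart) : M.faceNext d.symm = M.rot d := by
  simp [faceNext, symmPerm]

theorem faceNext_fst (M : RotationSystem H) (d : H.Dart) : (M.faceNext d).fst = d.snd :=
  M.rot_fst d.symm

theorem face_eq_iff (M : RotationSystem H) {d e : H.Dart} :
    M.face d = M.face e ↔ M.faceNext.SameCycle d e :=
  Quotient.eq (r := Equiv.Perm.SameCycle.setoid M.faceNext)

theorem face_faceNext (M : RotationSystem H) (d : H.Dart) : M.face (M.faceNext d) = M.face d :=
  M.face_eq_iff.2 (Equiv.Perm.sameCycle_apply_left.2 (Equiv.Perm.SameCycle.refl _ _))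

/-- The corner between `d` and `rot d` lies in the face on the reverse side of `d`. -/
theorem face_rot (M : RotationSystem H) (d : H.Dart) : M.face (M.rot d) = M.face d.symm := by
  rw [← faceNext_symm, face_faceNext]

theorem face_surjective (M : RotationSystem H) (f : M.Face) : ∃ d, M.face d = f :=
  Quotient.exists_rep f

end RotationSystem

/-! ### Cycles of a permutation -/

section Permutations

variable {α : Type*}

theorem Equiv.Perm.SameCycle.induction [Finite α] {σ : Equiv.Perm α} {p : α → Prop} {x y : α}
    (h : σ.SameCycle x y) (hx : p x) (hp : ∀ z, σ.SameCycle x z → p z → p (σ z)) : p y := by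
  obtain ⟨n, rfl⟩ := h.exists_nat_pow_eq
  induction n with
  | zero => exact hx
  | succ n ih =>
    rw [pow_succ', Equiv.Perm.mul_apply]
    exact hp _ ⟨n, by simp⟩ (ih ⟨n, by simp⟩)

/-- On a cycle along which a predicate is not constant, it becomes true at some step. -/
theorem Equiv.Perm.SameCycle.exists_step [Finite α] {σ : Equiv.Perm α} {p : α → Prop} {x y : α}
    (h : σ.SameCycle x y) (hx : ¬ p x) (hy : p y) :
    ∃ z, σ.SameCycle x z ∧ ¬ p (σ.symm z) ∧ p z := by
  by_contra! hcon
  refine h.induction (p := fun z => ¬ p z) hx (fun z hz hpz => ?_) hy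
  exact hcon (σ z) (Equiv.Perm.sameCycle_apply_right.2 hz) (by simpa using hpz)

end Permutations

/-! ### Cycles bound sets of faces -/

section Homology

open scoped Classical in
/-- The vertex-edge incidence matrix over the field with two elements; as a linear map it is the
boundary operator from edges to vertices. -/
noncomputable def incidence {V : Type*} (H : SimpleGraph V) : Matrix V H.edgeSet (ZMod 2) :=
  fun x e => if x ∈ e.1 then 1 else 0

/-- The edge underlying a dart, as an element of the edge set. -/
def dartEdge {V : Type*} {H : SimpleGraph V} (d : H.Dart) : H.edgeSet := ⟨d.edge, d.edge_mem⟩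

variable {V : Type*} {H : SimpleGraph V}

theorem dartEdge_surjective : Function.Surjective (dartEdge (H := H)) := by
  rintro ⟨e, he⟩
  induction e with
  | h x y => exact ⟨⟨(x, y), he⟩, rfl⟩

theorem dartEdge_symm (d : H.Dart) : dartEdge d.symm = dartEdge d :=
  Subtype.ext d.edge_symm

theorem dartEdge_eq_iff {d e : H.Dart} : dartEdge d = dartEdge e ↔ d = e ∨ d = e.symm := by
  rw [← SimpleGraph.dart_edge_eq_iff]
  exact Subtype.ext_iff

theorem dartEdge_eq_iff_edge_eq {d : H.Dart} {x y : V} (h : H.Adj x y) :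
    dartEdge d = dartEdge ⟨(x, y), h⟩ ↔ d.edge = s(x, y) :=
  Subtype.ext_iff

theorem fst_mem_of_edge_eq {d : H.Dart} {x y : V} (h : d.edge = s(x, y)) :
    d.fst = x ∨ d.fst = y :=
  Sym2.mem_iff.1 (h ▸ Sym2.mem_mk_left d.fst d.snd)

/-- A dart chosen on every edge. -/
noncomputable def edgeDart (e : H.edgeSet) : H.Dart := (dartEdge_surjective e).choose

theorem dartEdge_edgeDart (e : H.edgeSet) : dartEdge (edgeDart e) = e :=
  (dartEdge_surjective e).choose_spec

/-- The boundary operator from faces to edges over the field with two elements: an edge gets the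
sum of the values of the faces on its two sides. -/
noncomputable def faceBoundary (M : RotationSystem H) :
    (M.Face → ZMod 2) →ₗ[ZMod 2] (H.edgeSet → ZMod 2) where
  toFun τ e := τ (M.face (edgeDart e)) + τ (M.face (edgeDart e).symm)
  map_add' _ _ := by ext; simp; ring
  map_smul' _ _ := by ext; simp; ring

theorem faceBoundary_apply (M : RotationSystem H) (τ : M.Face → ZMod 2) (d : H.Dart) :
    faceBoundary M τ (dartEdge d) = τ (M.face d) + τ (M.face d.symm) := by
  change τ (M.face (edgeDart (dartEdge d))) + τ (M.face (edgeDart (dartEdge d)).symm) = _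
  rcases dartEdge_eq_iff.1 (dartEdge_edgeDart (dartEdge d)) with h | h <;> rw [h]
  rw [SimpleGraph.Dart.symm_symm, add_comm]

theorem incidence_mulVec_single [Fintype H.edgeSet] [DecidableEq V] [DecidableEq H.edgeSet]
    (d : H.Dart) :
    (incidence H).mulVec (Pi.single (dartEdge d) 1) = Pi.single d.fst 1 + Pi.single d.snd 1 := by
  ext x
  have hne := d.adj.ne
  have : x ∈ d.edge ↔ x = d.fst ∨ x = d.snd := by
    rw [SimpleGraph.Dart.edge, ← Prod.mk.eta (p := d.toProd)]; simp
  simp only [Matrix.mulVec_single, dartEdge, Pi.add_apply, Pi.single_apply]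
  by_cases h1 : x = d.fst <;> by_cases h2 : x = d.snd <;> simp_all [incidence]

instance [Finite V] : Finite H.Dart :=
  Finite.of_injective (fun d => d.toProd) (fun _ _ h => SimpleGraph.Dart.ext _ _ h)

instance [Finite V] (M : RotationSystem H) : Finite M.Face := Quotient.finite _

theorem incidence_mulVec_apply [Fintype V] [Fintype H.edgeSet] [Fintype H.Dart] [DecidableEq V]
    (c : H.edgeSet → ZMod 2) (x : V) :
    (incidence H).mulVec c x = ∑ d : H.Dart with d.fst = x, c (dartEdge d) := by
  classical
  simp only [Matrix.mulVec, dotProduct, incidence, ite_mul, one_mul, zero_mul, ← Finset.sum_filter]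
  symm
  refine Finset.sum_bij (fun d _ => dartEdge d) ?_ ?_ ?_ (fun _ _ => rfl)
  · intro d hd
    simp only [Finset.mem_filter, Finset.mem_univ, true_and] at hd ⊢
    rw [← hd]
    exact Sym2.mem_mk_left _ _
  · intro d hd e he h
    simp only [Finset.mem_filter, Finset.mem_univ, true_and] at hd he
    rcases dartEdge_eq_iff.1 h with h | h
    · exact h
    · subst h
      exact absurd (he.trans hd.symm) e.adj.ne
  · intro e he
    simp only [Finset.mem_filter, Finset.mem_univ, true_and] at he
    obtain ⟨d, rfl⟩ := dartEdge_surjective e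
    rcases Sym2.mem_iff.1 (show x ∈ s(d.fst, d.snd) from he) with h | h
    · exact ⟨d, by simp [h], rfl⟩
    · exact ⟨d.symm, by simp [h], dartEdge_symm d⟩

theorem incidence_mulVec_faceBoundary [Fintype V] [Fintype H.edgeSet] (M : RotationSystem H)
    (τ : M.Face → ZMod 2) : (incidence H).mulVec (faceBoundary M τ) = 0 := by
  classical
  have := Fintype.ofFinite H.Dart
  ext x
  simp only [incidence_mulVec_apply, faceBoundary_apply, ← M.face_rot, Finset.sum_add_distrib]
  have : ∑ d : H.Dart with d.fst = x, τ (M.face (M.rot d)) =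
      ∑ d : H.Dart with d.fst = x, τ (M.face d) :=
    Finset.sum_equiv M.rot (by simp [M.rot_fst]) (fun _ _ => rfl)
  rw [this]
  exact CharTwo.add_self_eq_zero _

/-- If a function on faces agrees across all edges at a vertex, it is constant around the vertex. -/
theorem RotationSystem.eq_of_fst_eq [Finite V] (M : RotationSystem H) {β : Type*} {g : M.Face → β}
    {d e : H.Dart} (h : d.fst = e.fst)
    (hg : ∀ d', d'.fst = e.fst → g (M.face d') = g (M.face d'.symm)) :
    g (M.face d) = g (M.face e) := by
  have hfst : ∀ z, M.rot.SameCycle d z → z.fst = e.fst := fun z hz =>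
    hz.induction (p := fun z => z.fst = e.fst) h fun z _ hz => (M.rot_fst z).trans hz
  refine (M.rot_sameCycle d e h).induction (p := fun e => g (M.face d) = g (M.face e)) rfl ?_
  intro z hdz hz
  rw [M.face_rot, ← hg z (hfst z hdz)]
  exact hz

/-- In a connected graph every vertex function which is constant along edges is constant. -/
theorem eq_of_forall_adj {β : Type*} (hH : H.Connected) {g : V → β}
    (hg : ∀ x y, H.Adj x y → g x = g y) (x y : V) : g x = g y := by
  obtain ⟨p⟩ := hH.preconnected x y
  induction p with
  | nil => rfl
  | cons h _ ih => exact (hg _ _ h).trans ih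

/-- **Jordan curve theorem over the field with two elements.** In a plane embedding every edge chain
without boundary is the boundary of a set of faces. Faces bound cycles, and by Euler's formula both
spaces have the same dimension. -/
theorem PlaneEmbedding.exists_faceBoundary_eq [Finite V] [Fintype H.edgeSet] (M : PlaneEmbedding H)
    {c : H.edgeSet → ZMod 2} (hc : (incidence H).mulVec c = 0) :
    ∃ τ, faceBoundary M.toRotationSystem τ = c := by
  classical
  have := Fintype.ofFinite V
  have := Fintype.ofFinite M.Face
  have hle : LinearMap.range (faceBoundary M.toRotationSystem) ≤
      LinearMap.ker (incidence H).mulVecLin := by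
    rintro _ ⟨τ, rfl⟩
    exact incidence_mulVec_faceBoundary M.toRotationSystem τ
  -- both kernels below consist of constant functions; together with `rank_transpose` this bounds
  -- the cycle space from above and the space of face boundaries from below
  have hconst : ∀ {β : Type _} [Fintype β] (K : Submodule (ZMod 2) (β → ZMod 2)),
      (∀ g ∈ K, ∀ x y, g x = g y) → Module.finrank (ZMod 2) K ≤ 1 := by
    intro β _ K hK
    have : K ≤ Submodule.span (ZMod 2) {fun _ => 1} := by
      intro g hg
      rw [Submodule.mem_span_singleton]
      rcases isEmpty_or_nonempty β with h | ⟨⟨x⟩⟩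
      · exact ⟨0, Subsingleton.elim _ _⟩
      · exact ⟨g x, funext fun y => by simp [hK g hg x y]⟩
    exact (Submodule.finrank_mono this).trans 
      ((finrank_span_le_card _).trans (by rw [Set.toFinset_singleton, Finset.card_singleton]))
  have hface : Module.finrank (ZMod 2) (LinearMap.ker (faceBoundary M.toRotationSystem)) ≤ 1 := by
    refine hconst _ fun g hg f f' => ?_
    have hd : ∀ d, g (M.face d) = g (M.face d.symm) := fun d => by
      have := faceBoundary_apply M.toRotationSystem g d
      rw [LinearMap.mem_ker.1 hg] at this
      exact CharTwo.add_eq_zero.1 this.symm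
    have hv := fun d e h => M.eq_of_fst_eq (d := d) (e := e) h fun d _ => hd d
    have key : ∀ x y, ∀ d e : H.Dart, d.fst = x → e.fst = y → g (M.face d) = g (M.face e) := by
      intro x y
      obtain ⟨p⟩ := M.connected.preconnected x y
      induction p with
      | nil => exact fun d e hd he => hv d e (hd.trans he.symm)
      | cons h _ ih =>
        intro d e hx hy
        have h1 := hv d ⟨(_, _), h⟩ hx
        rw [h1, hd]
        exact ih _ _ rfl hy
    obtain ⟨d, rfl⟩ := M.face_surjective f
    obtain ⟨e, rfl⟩ := M.face_surjective f'
    exact key _ _ d e rfl rfl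
  have hvert : Module.finrank (ZMod 2) (LinearMap.ker (incidence H).transpose.mulVecLin) ≤ 1 := by
    refine hconst _ fun g hg => eq_of_forall_adj M.connected fun x y hxy => ?_
    have h0 := congrFun (LinearMap.mem_ker.1 hg) ⟨s(x, y), hxy⟩
    have h1 := congrArg (dotProduct g) (incidence_mulVec_single (H := H) ⟨(x, y), hxy⟩)
    rw [Matrix.dotProduct_mulVec, dotProduct_single, ← Matrix.mulVec_transpose, mul_one] at h1
    have h2 : g x + g y = 0 := by
      rw [dotProduct_add, dotProduct_single, dotProduct_single, mul_one, mul_one] at h1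
      exact h1.symm.trans h0
    exact CharTwo.add_eq_zero.1 h2
  have e1 := LinearMap.finrank_range_add_finrank_ker (faceBoundary M.toRotationSystem)
  have e2 := LinearMap.finrank_range_add_finrank_ker (incidence H).mulVecLin
  have e3 := LinearMap.finrank_range_add_finrank_ker (incidence H).transpose.mulVecLin
  have e4 : Module.finrank (ZMod 2) (LinearMap.range (incidence H).transpose.mulVecLin) =
      Module.finrank (ZMod 2) (LinearMap.range (incidence H).mulVecLin) :=
    Matrix.rank_transpose (incidence H)
  have euler := M.euler
  rw [Nat.card_eq_fintype_card, Nat.card_eq_fintype_card, ← Nat.card_coe_set_eq,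
    Nat.card_eq_fintype_card] at euler
  rw [Module.finrank_fintype_fun_eq_card] at e1 e2 e3
  have heq := Submodule.eq_of_le_of_finrank_le hle (by omega)
  have : c ∈ LinearMap.range (faceBoundary M.toRotationSystem) := by
    rw [heq]; exact hc
  exact this

end Homology

/-! ### Acyclic digraphs -/

section Acyclic

variable {V : Type*} {G : Digraph V}

theorem Digraph.wellFounded_transGen [Finite V] (hG : ∀ v, ¬ TransGen G.Adj v v) :
    WellFounded (TransGen G.Adj) :=
  have : Std.Irrefl (TransGen G.Adj) := ⟨hG⟩
  Finite.wellFounded_of_trans_of_irrefl _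

theorem Digraph.wellFounded_transGen_swap [Finite V] (hG : ∀ v, ¬ TransGen G.Adj v v) :
    WellFounded (Function.swap (TransGen G.Adj)) :=
  have : Std.Irrefl (Function.swap (TransGen G.Adj)) := ⟨hG⟩
  have : IsTrans V (Function.swap (TransGen G.Adj)) := ⟨fun _ _ _ h h' => TransGen.trans h' h⟩
  Finite.wellFounded_of_trans_of_irrefl _

theorem Digraph.not_reflTransGen_of_adj (hG : ∀ v, ¬ TransGen G.Adj v v) {x y : V}
    (h : G.Adj x y) : ¬ ReflTransGen G.Adj y x :=
  fun h' => hG x (TransGen.head' h h')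

theorem Digraph.toSimpleGraphInclusive_adj_of_adj (hG : ∀ v, ¬ TransGen G.Adj v v) {x y : V}
    (h : G.Adj x y) : G.toSimpleGraphInclusive.Adj x y :=
  ⟨by rintro rfl; exact hG _ (.single h), Or.inl h⟩

end Acyclic

namespace IsPlanarSTDigraph

variable {V : Type*} [Finite V] {G : Digraph V} {M : PlaneEmbedding G.toSimpleGraphInclusive}
  {s t : V}

theorem reflTransGen_source (h : IsPlanarSTDigraph G M s t) (x : V) :
    ReflTransGen G.Adj s x := by
  induction x using (Digraph.wellFounded_transGen h.acyclic).induction with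
  | _ x ih =>
    by_cases hx : x = s
    · rw [hx]
    · have := mt (h.source x).1 hx
      push Not at this
      obtain ⟨u, hu⟩ := this
      exact (ih u (.single hu)).tail hu

theorem reflTransGen_sink (h : IsPlanarSTDigraph G M s t) (x : V) :
    ReflTransGen G.Adj x t := by
  induction x using (Digraph.wellFounded_transGen_swap h.acyclic).induction with
  | _ x ih =>
    by_cases hx : x = t
    · rw [hx]
    · have := mt (h.sink x).1 hx
      push Not at this
      obtain ⟨u, hu⟩ := this
      exact (ih u (.single hu)).head hu

end IsPlanarSTDigraph

/-! ### Directed paths and rhombi -/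

section Separation

variable {V : Type*}

/-- A directed path, as an edge chain: its boundary consists of its two ends, and its edges join
vertices lying between them. -/
theorem Digraph.exists_pathChain {G : Digraph V} (hG : ∀ v, ¬ TransGen G.Adj v v)
    [Fintype G.toSimpleGraphInclusive.edgeSet] [DecidableEq V] {a b : V}
    (hab : ReflTransGen G.Adj a b) :
    ∃ c : G.toSimpleGraphInclusive.edgeSet → ZMod 2,
      (incidence _).mulVec c = Pi.single a 1 + Pi.single b 1 ∧
      ∀ d, c (dartEdge d) ≠ 0 → ReflTransGen G.Adj a d.fst ∧ ReflTransGen G.Adj d.fst b := by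
  classical
  induction hab with
  | refl => exact ⟨0, by
      rw [Matrix.mulVec_zero]
      exact funext fun z => (CharTwo.add_self_eq_zero _).symm, by simp⟩
  | @tail x y hax hxy ih =>
    obtain ⟨c, hc, hc'⟩ := ih
    refine ⟨c + Pi.single (dartEdge ⟨(x, y), toSimpleGraphInclusive_adj_of_adj hG hxy⟩) 1, ?_, ?_⟩
    · rw [Matrix.mulVec_add, hc, incidence_mulVec_single]
      have : ∀ p q r : ZMod 2, p + q + (q + r) = p + r := by decide
      exact funext fun z => this _ _ _
    · intro d hd
      by_cases hcd : c (dartEdge d) = 0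
      · rw [Pi.add_apply, hcd, zero_add, Pi.single_apply] at hd
        rcases dartEdge_eq_iff.1 (ite_ne_right_iff.1 hd).1 with rfl | rfl
        · exact ⟨hax, .single hxy⟩
        · exact ⟨hax.tail hxy, .refl⟩
      · exact ⟨(hc' d hcd).1, (hc' d hcd).2.tail hxy⟩

variable [Finite V]

/-- If a function on faces agrees across all edges at the vertices reachable from `x`, then its
value at `x` spreads to all faces at these vertices. -/
theorem RotationSystem.face_eq_of_reflTransGen {H : SimpleGraph V} (M : RotationSystem H)
    {β : Type*} {g : M.Face → β} {r : V → V → Prop} (hr : ∀ x y, r x y → H.Adj x y) {x y : V}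
    (hxy : ReflTransGen r x y)
    (hg : ∀ d : H.Dart, ReflTransGen r x d.fst → g (M.face d) = g (M.face d.symm))
    {d e : H.Dart} (hd : d.fst = x) (he : e.fst = y) : g (M.face d) = g (M.face e) := by
  induction hxy generalizing e with
  | refl => exact M.eq_of_fst_eq (hd.trans he.symm) fun d' hd' => hg d' (by rw [hd', he])
  | @tail z w hxz hzw ih =>
    rw [ih (e := ⟨(z, w), hr _ _ hzw⟩) rfl, hg _ hxz]
    exact M.eq_of_fst_eq he.symm fun d' hd' => hg d' (by rw [hd', he]; exact hxz.tail hzw)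

/-- No directed path joins the two side vertices of a rhombus. Together with the edges at `u`, a
path from `a` to `b` would bound a set `T` of faces; adding the rhombus gives a set `T'` bounded by
the path and the edges at `v`. Take both without the external face. One of them contains the faces
at the median: if it is `T`, then `v` is enclosed and cannot reach the sink without meeting the
path again, and if it is `T'`, then `u` is enclosed and cannot be reached from the source. -/
theorem IsRhombus.not_reflTransGen {G : Digraph V} {M : PlaneEmbedding G.toSimpleGraphInclusive}
    {s t : V} (hst : IsPlanarSTDigraph G M s t) {u v a b : V} (h : IsRhombus G M u v a b) :
    ¬ ReflTransGen G.Adj a b := by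
  classical
  intro hab
  obtain ⟨⟨hne, huv, hua, hav, hub, hbv⟩, S, hout, hS, hmed⟩ := h
  have := Fintype.ofFinite G.toSimpleGraphInclusive.edgeSet
  have hG := hst.acyclic
  have nr := @Digraph.not_reflTransGen_of_adj _ _ hG
  have adj := @Digraph.toSimpleGraphInclusive_adj_of_adj _ _ hG
  obtain ⟨c, hc, hc'⟩ := Digraph.exists_pathChain hG hab
  obtain ⟨τ₀, hτ₀⟩ := M.exists_faceBoundary_eq
    (c := c + Pi.single (dartEdge ⟨(u, a), adj hua⟩) 1 +
      Pi.single (dartEdge ⟨(u, b), adj hub⟩) 1) (by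
    rw [Matrix.mulVec_add, Matrix.mulVec_add, hc, incidence_mulVec_single, incidence_mulVec_single]
    ext x
    have : ∀ p q r : ZMod 2, p + q + (r + p) + (r + q) = 0 := by decide
    exact this _ _ _)
  have hτ : ∀ d, (τ₀ (M.face d) + τ₀ M.outer) + (τ₀ (M.face d.symm) + τ₀ M.outer) =
      c (dartEdge d) + (if d.edge = s(u, a) then 1 else 0) +
        (if d.edge = s(u, b) then 1 else 0) := by
    intro d
    have h1 := congrFun hτ₀ (dartEdge d)
    rw [faceBoundary_apply] at h1
    simp only [Pi.add_apply, Pi.single_apply, dartEdge_eq_iff_edge_eq] at h1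
    rw [← h1, add_add_add_comm, CharTwo.add_self_eq_zero, add_zero]
  -- adding a constant does not change the boundary and removes the external face
  set τ : M.Face → ZMod 2 := fun f => τ₀ f + τ₀ M.outer
  replace hτ : ∀ d, τ (M.face d) + τ (M.face d.symm) =
      c (dartEdge d) + (if d.edge = s(u, a) then 1 else 0) +
        (if d.edge = s(u, b) then 1 else 0) := hτ
  have hτout : τ M.outer = 0 := CharTwo.add_self_eq_zero _
  clear_value τ
  let m : G.toSimpleGraphInclusive.Dart := ⟨(v, u), (adj huv).symm⟩
  by_cases hm : τ (M.face m) = 0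
  · -- the set `T'`, given by the sum of `τ` and the indicator function of `S`
    obtain ⟨e, he, hes⟩ := hst.source_outer
    have key := M.face_eq_of_reflTransGen (g := fun f => τ f + if f ∈ S then 1 else 0)
      (r := Function.swap G.Adj) (x := u) (y := s) (fun x y h => (adj h).symm)
      (reflTransGen_swap.2 (hst.reflTransGen_source u)) ?_ (d := m.symm) (e := e) rfl hes
    · have h1 : M.face m ∈ S := hmed m Sym2.eq_swap
      have h2 : M.face m.symm ∈ S := hmed m.symm rfl
      have h3 : τ (M.face m.symm) = τ (M.face m) := by
        have hcm : c (dartEdge m) = 0 := by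
          by_contra hcm
          exact nr hbv (hc' m hcm).2
        have h4 := hτ m
        have e1 : ¬ m.edge = s(u, a) := fun h => by
          rcases fst_mem_of_edge_eq h with h | h
          · exact (adj huv).ne h.symm
          · exact (adj hav).ne h.symm
        have e2 : ¬ m.edge = s(u, b) := fun h => by
          rcases fst_mem_of_edge_eq h with h | h
          · exact (adj huv).ne h.symm
          · exact (adj hbv).ne h.symm
        rw [hcm, if_neg e1, if_neg e2, add_zero, add_zero] at h4
        exact (CharTwo.add_eq_zero.1 h4).symm
      simp [h2, h3, hm, he, hτout, hout] at key
    · intro d hd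
      have hd : ReflTransGen G.Adj d.fst u := reflTransGen_swap.1 hd
      have hcd : c (dartEdge d) = 0 := by
        by_contra hcd
        exact nr hua ((hc' d hcd).1.trans hd)
      have hda : d.fst ≠ a := fun h => nr hua (h ▸ hd)
      have hdb : d.fst ≠ b := fun h => nr hub (h ▸ hd)
      have hdv : d.fst ≠ v := fun h => nr huv (h ▸ hd)
      have n1 : ¬ d.edge = s(a, v) := fun h => (fst_mem_of_edge_eq h).elim hda hdv
      have n2 : ¬ d.edge = s(b, v) := fun h => (fst_mem_of_edge_eq h).elim hdb hdv
      have n3 : d.edge = s(u, a) → ¬ d.edge = s(u, b) := fun h h' =>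
        hne (Sym2.congr_right.1 (h.symm.trans h'))
      have h1 := hS d
      have h2 := hτ d
      simp only [n1, n2, false_or, or_false, hcd, zero_add] at h1 h2
      have h3 : ((if d.edge = s(u, a) then 1 else 0) + (if d.edge = s(u, b) then 1 else 0) : ZMod 2)
          = (if M.face d ∈ S then 1 else 0) + (if M.face d.symm ∈ S then 1 else 0) := by
        have (P Q A B : Prop) [Decidable P] [Decidable Q] (h : ¬ (A ↔ B) ↔ P ∨ Q) (h' : P → ¬ Q) :
            ((if P then 1 else 0) + (if Q then 1 else 0) : ZMod 2) =
              (if A then 1 else 0) + (if B then 1 else 0) := by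
          by_cases P <;> by_cases Q <;> by_cases A <;> by_cases B <;>
            simp_all [CharTwo.add_self_eq_zero]
        exact this _ _ _ _ h1 n3
      have h4 : ∀ A B C D : ZMod 2, A + B = C + D → A + C = B + D := by decide
      exact h4 _ _ _ _ (h2.trans h3)
  · -- the set `T`, given by `τ`
    obtain ⟨e, he, het⟩ := hst.sink_outer
    refine hm ?_
    rw [← hτout, ← he]
    refine M.face_eq_of_reflTransGen (g := τ) (r := G.Adj) (x := v) (fun x y h => adj h)
      (hst.reflTransGen_sink v) ?_ rfl het
    intro d hd
    have hcd : c (dartEdge d) = 0 := by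
      by_contra hcd
      exact nr hbv (hd.trans (hc' d hcd).2)
    have hda : d.fst ≠ a := fun h => nr hav (h ▸ hd)
    have hdb : d.fst ≠ b := fun h => nr hbv (h ▸ hd)
    have hdu : d.fst ≠ u := fun h => nr huv (h ▸ hd)
    have h2 := hτ d
    rw [hcd, if_neg fun h => (fst_mem_of_edge_eq h).elim hdu hda,
      if_neg fun h => (fst_mem_of_edge_eq h).elim hdu hdb, add_zero, add_zero] at h2
    exact CharTwo.add_eq_zero.1 h2

end Separation

/-! ### Triangular faces -/

section Triangles

variable {V : Type*}

namespace RotationSystem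

variable {H : SimpleGraph V}

/-- The third vertex of the face of `d`, if this face is a triangle. -/
def apex (M : RotationSystem H) (d : H.Dart) : V := (M.faceNext d).snd

theorem apex_ne_snd (M : RotationSystem H) (d : H.Dart) : M.apex d ≠ d.snd := by
  rw [← M.faceNext_fst]
  exact (M.faceNext d).adj.ne'

variable [Finite V] {M : RotationSystem H} {d : H.Dart}

theorem IsTriangle.faceNext_cube_and_face_eq_iff
    (hd : M.IsTriangle (M.face d)) :
    M.faceNext (M.faceNext (M.faceNext d)) = d ∧
      ∀ e, M.face e = M.face d ↔ e = d ∨ e = M.faceNext d ∨ e = M.faceNext (M.faceNext d) := by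
  have hne : ∀ e : H.Dart, M.faceNext e ≠ e := fun e h =>
    e.adj.ne (by rw [← congrArg (fun e => e.fst) h]; exact M.faceNext_fst e)
  have hne' : M.faceNext (M.faceNext d) ≠ d := by
    intro h
    have hsub : {e | M.face e = M.face d} ⊆ {d, M.faceNext d} := by
      intro e he
      refine (M.face_eq_iff.1 he.symm).induction (p := fun e => e ∈ ({d, M.faceNext d} : Set _))
        (Or.inl rfl) ?_
      rintro z - (rfl | rfl)
      · exact Or.inr rfl
      · exact Or.inl h
    have h3 : {e | M.face e = M.face d}.ncard = 3 := hd
    have h1 := Set.ncard_le_ncard hsub (Set.toFinite _)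
    have h2 := Set.ncard_insert_le d {M.faceNext d}
    rw [Set.ncard_singleton] at h2
    omega
  have hsub : {d, M.faceNext d, M.faceNext (M.faceNext d)} ⊆ {e | M.face e = M.face d} := by
    rintro _ (rfl | rfl | rfl) <;> simp [face_faceNext]
  have hcard : ({d, M.faceNext d, M.faceNext (M.faceNext d)} : Set H.Dart).ncard = 3 :=
    Set.ncard_eq_three.2 ⟨_, _, _, (hne d).symm, hne'.symm, (hne _).symm, rfl⟩
  have heq := Set.eq_of_subset_of_ncard_le hsub
    (by rw [hcard]; exact le_of_eq hd) (Set.toFinite _)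
  have hiff : ∀ e, M.face e = M.face d ↔
      e = d ∨ e = M.faceNext d ∨ e = M.faceNext (M.faceNext d) := fun e =>
    (Set.ext_iff.1 heq e).symm
  refine ⟨?_, hiff⟩
  rcases (hiff (M.faceNext (M.faceNext (M.faceNext d)))).1 (by simp [face_faceNext]) with h | h | h
  · exact h
  · exact absurd (M.faceNext.injective h) hne'
  · exact absurd h (hne _)

theorem IsTriangle.snd_faceNext_faceNext (hd : M.IsTriangle (M.face d)) :
    (M.faceNext (M.faceNext d)).snd = d.fst := by
  rw [← M.faceNext_fst, hd.faceNext_cube_and_face_eq_iff.1]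

theorem IsTriangle.apex_ne_fst (hd : M.IsTriangle (M.face d)) : M.apex d ≠ d.fst := by
  have h := (M.faceNext (M.faceNext d)).adj.ne
  rwa [hd.snd_faceNext_faceNext, M.faceNext_fst] at h

theorem IsTriangle.face_eq_iff_fst_snd (hd : M.IsTriangle (M.face d)) (e : H.Dart) :
    M.face e = M.face d ↔ e.fst = d.fst ∧ e.snd = d.snd ∨ e.fst = d.snd ∧ e.snd = M.apex d ∨
      e.fst = M.apex d ∧ e.snd = d.fst := by
  rw [hd.faceNext_cube_and_face_eq_iff.2]
  simp only [SimpleGraph.Dart.ext_iff, Prod.ext_iff, faceNext_fst, hd.snd_faceNext_faceNext]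
  rfl

theorem IsTriangle.faceVerts_eq (hd : M.IsTriangle (M.face d)) :
    M.faceVerts (M.face d) = {d.fst, d.snd, M.apex d} := by
  ext x
  constructor
  · rintro ⟨e, he, rfl⟩
    rcases (hd.face_eq_iff_fst_snd e).1 he with h | h | h <;> simp [h.1]
  · rintro (rfl | rfl | rfl)
    · exact ⟨d, rfl, rfl⟩
    · exact ⟨_, M.face_faceNext d, M.faceNext_fst d⟩
    · exact ⟨_, (M.face_faceNext _).trans (M.face_faceNext d), M.faceNext_fst _⟩

end RotationSystem

variable [Finite V]

/-- Two interior triangles on the two sides of the median form a rhombus, whose interior consists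
of these two faces. -/
theorem isRhombus_of_isTriangle {G : Digraph V} {M : PlaneEmbedding G.toSimpleGraphInclusive}
    {u v a b : V} (hG : IsRhombusGraph G u v a b) {d : G.toSimpleGraphInclusive.Dart}
    (hd : d.edge = s(u, v)) (ho : M.face d ≠ M.outer) (ho' : M.face d.symm ≠ M.outer)
    (ht : M.IsTriangle (M.face d)) (ht' : M.IsTriangle (M.face d.symm))
    (ha : M.apex d = a) (hb : M.apex d.symm = b) : IsRhombus G M u v a b := by
  refine ⟨hG, {M.face d, M.face d.symm}, ?_, fun e => ?_, fun e he => ?_⟩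
  · rintro (h | h)
    exacts [ho h.symm, ho' h.symm]
  · have n1 := d.adj.ne
    have n2 := M.apex_ne_snd d
    have n3 := M.apex_ne_snd d.symm
    have n4 := ht.apex_ne_fst
    have n5 := ht'.apex_ne_fst
    have n6 := hG.ne
    have hd' : s(d.fst, d.snd) = s(u, v) := hd
    rw [Sym2.eq_iff] at hd'
    change _ ↔ s(e.fst, e.snd) = _ ∨ s(e.fst, e.snd) = _ ∨ s(e.fst, e.snd) = _ ∨
      s(e.fst, e.snd) = _
    have f1 : d.symm.fst = d.snd := rfl
    have f2 : d.symm.snd = d.fst := rfl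
    have f3 : e.symm.fst = e.snd := rfl
    have f4 : e.symm.snd = e.fst := rfl
    simp only [Set.mem_insert_iff, Set.mem_singleton_iff, ht.face_eq_iff_fst_snd,
      ht'.face_eq_iff_fst_snd, ha, hb, f1, f2, f3, f4, Sym2.eq_iff] at *
    generalize d.fst = p at *
    generalize d.snd = q at *
    generalize e.fst = x at *
    generalize e.snd = y at *
    clear ho ho' ht ht' hG ha hb hd f1 f2 f3 f4
    rcases hd' with ⟨rfl, rfl⟩ | ⟨rfl, rfl⟩ <;> grind
  · rcases (SimpleGraph.dart_edge_eq_iff _ _).1 (he.trans hd.symm) with rfl | rfl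
    exacts [Or.inl rfl, Or.inr rfl]

theorem IsFacialRhombus.isRhombus {G : Digraph V} {M : PlaneEmbedding G.toSimpleGraphInclusive}
    {s t : V} (hst : IsPlanarSTDigraph G M s t) {u v a b : V} (h : IsFacialRhombus G M u v a b) :
    IsRhombus G M u v a b := by
  obtain ⟨hG, ⟨d, hd, ho, ho', ht, ht', hv, hv'⟩, -⟩ := h
  have ne : ∀ {x y}, G.Adj x y → x ≠ y := fun h =>
    (Digraph.toSimpleGraphInclusive_adj_of_adj hst.acyclic h).ne
  have hd' : s(d.fst, d.snd) = s(u, v) := hd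
  have h1 := ne hG.u_a
  have h2 := ne hG.a_v
  have h3 := ne hG.u_b
  have h4 := ne hG.b_v
  have ha : a ∈ M.faceVerts (M.face d) := by simp [hv]
  have hb : b ∈ M.faceVerts (M.face d.symm) := by simp [hv']
  rw [ht.faceVerts_eq] at ha
  rw [ht'.faceVerts_eq] at hb
  have f1 : d.symm.fst = d.snd := rfl
  have f2 : d.symm.snd = d.fst := rfl
  rw [Sym2.eq_iff] at hd'
  simp only [Set.mem_insert_iff, Set.mem_singleton_iff, f1, f2] at ha hb
  refine isRhombus_of_isTriangle hG hd ho ho' ht ht' ?_ ?_ <;> grind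

end Triangles

/-! ### Hamiltonian paths -/

section Hamiltonian

variable {V : Type*} {G : Digraph V}

theorem HasHamiltonianPath.reflTransGen_total (h : HasHamiltonianPath G) (a b : V) :
    ReflTransGen G.Adj a b ∨ ReflTransGen G.Adj b a := by
  obtain ⟨l, hl, -, hmem⟩ := h
  have hp : l.Pairwise (TransGen G.Adj) :=
    List.isChain_iff_pairwise.1 (hl.imp fun _ _ h => TransGen.single h)
  by_cases hab : a = b
  · exact Or.inl (hab ▸ .refl)
  · have : Std.Symm fun x y => ReflTransGen G.Adj x y ∨ ReflTransGen G.Adj y x :=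
      ⟨fun _ _ => Or.symm⟩
    exact (hp.imp (S := fun x y => ReflTransGen G.Adj x y ∨ ReflTransGen G.Adj y x)
      fun h => Or.inl h.to_reflTransGen).forall (hmem a) (hmem b) hab

/-- If every vertex other than `t` has an out-neighbour from which all its other successors can be
reached, then following these out-neighbours from the source gives a Hamiltonian path. -/
theorem hasHamiltonianPath_of_forall_exists [Finite V] (hG : ∀ v, ¬ TransGen G.Adj v v) {s t : V}
    (hs : ∀ x, ReflTransGen G.Adj s x) (ht : ∀ x, ¬ G.Adj t x)
    (hnext : ∀ v, v ≠ t → ∃ w, G.Adj v w ∧ ∀ x, G.Adj v x → ReflTransGen G.Adj w x) :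
    HasHamiltonianPath G := by
  have key : ∀ v, ∃ l, (v :: l).IsChain G.Adj ∧ ∀ x, ReflTransGen G.Adj v x → x ∈ v :: l := by
    intro v
    induction v using (Digraph.wellFounded_transGen_swap hG).induction with
    | _ v ih =>
      by_cases hv : v = t
      · subst hv
        refine ⟨[], .singleton _, fun x hx => ?_⟩
        rcases hx.cases_head with rfl | ⟨y, hy, -⟩
        · exact List.mem_singleton_self _
        · exact absurd hy (ht y)
      · obtain ⟨w, hvw, hw⟩ := hnext v hv
        obtain ⟨l, hl, hmem⟩ := ih w (.single hvw)
        refine ⟨w :: l, hl.cons_cons hvw, fun x hx => ?_⟩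
        rcases hx.cases_head with rfl | ⟨y, hy, hyx⟩
        · exact List.mem_cons_self
        · exact List.mem_cons_of_mem _ (hmem x ((hw y hy).trans hyx))
  obtain ⟨l, hl, hmem⟩ := key s
  refine ⟨s :: l, hl, ?_, fun x => hmem x (hs x)⟩
  have hp : (s :: l).Pairwise (TransGen G.Adj) :=
    List.isChain_iff_pairwise.1 (hl.imp fun _ _ h => TransGen.single h)
  refine List.Pairwise.imp (fun {x y} (h : TransGen G.Adj x y) => ?_) hp
  rintro rfl
  exact hG _ h

end Hamiltonian

/-! ### Corners -/

section Corners

variable {V : Type*} {G : Digraph V}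

/-- A dart is outgoing if its edge is directed along it. -/
def IsOut (d : G.toSimpleGraphInclusive.Dart) : Prop := G.Adj d.fst d.snd

theorem adj_of_not_isOut {d : G.toSimpleGraphInclusive.Dart} (hd : ¬ IsOut d) :
    G.Adj d.snd d.fst :=
  d.adj.2.resolve_left hd

theorem isOut_symm_iff (hG : ∀ v, ¬ TransGen G.Adj v v) (d : G.toSimpleGraphInclusive.Dart) :
    IsOut d.symm ↔ ¬ IsOut d :=
  ⟨fun h h' => Digraph.not_reflTransGen_of_adj hG h (.single h'), fun h => adj_of_not_isOut h⟩

namespace RotationSystem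

variable (M : RotationSystem G.toSimpleGraphInclusive)

/-- The corner between the dart `d` and its predecessor around their origin lies in the face of
`d`. It is a source corner if both darts are outgoing. -/
def IsSourceCorner (d : G.toSimpleGraphInclusive.Dart) : Prop := IsOut (M.rot.symm d) ∧ IsOut d

/-- The corner before `d` is a sink corner if both darts bounding it are incoming. -/
def IsSinkCorner (d : G.toSimpleGraphInclusive.Dart) : Prop := ¬ IsOut (M.rot.symm d) ∧ ¬ IsOut d

/-- The corner before `d` separates an incoming dart from the outgoing dart `d`. -/
def IsInOutCorner (d : G.toSimpleGraphInclusive.Dart) : Prop := ¬ IsOut (M.rot.symm d) ∧ IsOut d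

/-- The corner before `d` separates an outgoing dart from the incoming dart `d`. -/
def IsOutInCorner (d : G.toSimpleGraphInclusive.Dart) : Prop := IsOut (M.rot.symm d) ∧ ¬ IsOut d

theorem rot_symm_fst (d : G.toSimpleGraphInclusive.Dart) : (M.rot.symm d).fst = d.fst := by
  rw [← M.rot_fst, Equiv.apply_symm_apply]

theorem faceNext_symm_apply (d : G.toSimpleGraphInclusive.Dart) :
    M.faceNext.symm d = (M.rot.symm d).symm := by
  rw [Equiv.symm_apply_eq, faceNext_symm, Equiv.apply_symm_apply]

variable [Finite V] (hG : ∀ v, ¬ TransGen G.Adj v v)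
include hG

/-- By acyclicity the boundary walk of a face does not run against the edges all the time. -/
theorem exists_isOut_of_face (f : M.Face) : ∃ d, M.face d = f ∧ IsOut d := by
  obtain ⟨d, rfl⟩ := M.face_surjective f
  by_contra! hcon
  have hsc : M.faceNext.SameCycle d (M.faceNext.symm d) :=
    Equiv.Perm.sameCycle_symm_apply_right.2 (.refl _ _)
  have h1 := hsc.induction (p := fun z => ReflTransGen G.Adj z.fst d.fst) .refl fun z hz ih => by
    have := adj_of_not_isOut (hcon z (M.face_eq_iff.2 hz.symm))
    rw [← M.faceNext_fst] at this
    exact ih.head this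
  have h2 := adj_of_not_isOut (hcon _ (M.face_eq_iff.2 hsc.symm))
  rw [← M.faceNext_fst, Equiv.apply_symm_apply] at h2
  exact Digraph.not_reflTransGen_of_adj hG h2 h1

/-- By acyclicity the boundary walk of a face does not run along the edges all the time. -/
theorem exists_not_isOut_of_face (f : M.Face) : ∃ d, M.face d = f ∧ ¬ IsOut d := by
  obtain ⟨d, rfl⟩ := M.face_surjective f
  by_contra! hcon
  have hsc : M.faceNext.SameCycle d (M.faceNext.symm d) :=
    Equiv.Perm.sameCycle_symm_apply_right.2 (.refl _ _)
  have h1 := hsc.induction (p := fun z => ReflTransGen G.Adj d.fst z.fst) .refl fun z hz ih => by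
    have : G.Adj z.fst z.snd := hcon z (M.face_eq_iff.2 hz.symm)
    rw [← M.faceNext_fst] at this
    exact ih.tail this
  have h2 : G.Adj _ _ := hcon _ (M.face_eq_iff.2 hsc.symm)
  rw [← M.faceNext_fst, Equiv.apply_symm_apply] at h2
  exact Digraph.not_reflTransGen_of_adj hG h2 h1

theorem exists_isSourceCorner (f : M.Face) : ∃ d, M.face d = f ∧ M.IsSourceCorner d := by
  obtain ⟨d, rfl, hd⟩ := M.exists_not_isOut_of_face hG f
  obtain ⟨e, he, he'⟩ := M.exists_isOut_of_face hG (M.face d)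
  obtain ⟨z, hz, hz1, hz2⟩ := (M.face_eq_iff.1 he.symm).exists_step (p := IsOut) hd he'
  refine ⟨z, M.face_eq_iff.2 hz.symm, ?_, hz2⟩
  rwa [faceNext_symm_apply, isOut_symm_iff hG, not_not] at hz1

theorem exists_isSinkCorner (f : M.Face) : ∃ d, M.face d = f ∧ M.IsSinkCorner d := by
  obtain ⟨d, rfl, hd⟩ := M.exists_isOut_of_face hG f
  obtain ⟨e, he, he'⟩ := M.exists_not_isOut_of_face hG (M.face d)
  obtain ⟨z, hz, hz1, hz2⟩ :=
    (M.face_eq_iff.1 he.symm).exists_step (p := fun d => ¬ IsOut d) (not_not.2 hd) he'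
  refine ⟨z, M.face_eq_iff.2 hz.symm, ?_, hz2⟩
  rwa [faceNext_symm_apply, isOut_symm_iff hG, not_not] at hz1

end RotationSystem

end Corners

namespace IsPlanarSTDigraph

variable {V : Type*} {G : Digraph V} {M : PlaneEmbedding G.toSimpleGraphInclusive}
  {s t : V} (h : IsPlanarSTDigraph G M s t)
include h

theorem isOut_of_fst_eq_source {d : G.toSimpleGraphInclusive.Dart} (hd : d.fst = s) : IsOut d := by
  by_contra hout
  exact (h.source s).2 rfl _ (hd ▸ adj_of_not_isOut hout)

theorem not_isOut_of_fst_eq_sink {d : G.toSimpleGraphInclusive.Dart} (hd : d.fst = t) :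
    ¬ IsOut d := fun hout =>
  (h.sink t).2 rfl d.snd (by rw [← hd]; exact hout)

theorem exists_isOut {v : V} (hv : v ≠ t) :
    ∃ d : G.toSimpleGraphInclusive.Dart, d.fst = v ∧ IsOut d := by
  have := mt (h.sink v).1 hv
  push Not at this
  obtain ⟨u, hu⟩ := this
  exact ⟨⟨(v, u), Digraph.toSimpleGraphInclusive_adj_of_adj h.acyclic hu⟩, rfl, hu⟩

theorem exists_not_isOut {v : V} (hv : v ≠ s) :
    ∃ d : G.toSimpleGraphInclusive.Dart, d.fst = v ∧ ¬ IsOut d := by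
  have := mt (h.source v).1 hv
  push Not at this
  obtain ⟨u, hu⟩ := this
  refine ⟨⟨(v, u), (Digraph.toSimpleGraphInclusive_adj_of_adj h.acyclic hu).symm⟩, rfl, ?_⟩
  exact fun h' => Digraph.not_reflTransGen_of_adj h.acyclic hu (.single h')

theorem source_ne_sink : s ≠ t := by
  obtain ⟨d, -, hd⟩ := h.source_outer
  exact fun hst => h.not_isOut_of_fst_eq_sink (hd.trans hst) (h.isOut_of_fst_eq_source hd)

theorem fst_ne_of_isInOutCorner {d : G.toSimpleGraphInclusive.Dart} (hd : M.IsInOutCorner d) :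
    d.fst ≠ s ∧ d.fst ≠ t :=
  ⟨fun hs => hd.1 (h.isOut_of_fst_eq_source ((M.rot_symm_fst d).trans hs)),
    fun ht => h.not_isOut_of_fst_eq_sink ht hd.2⟩

variable [Finite V]

theorem exists_isInOutCorner {v : V} (hs : v ≠ s) (ht : v ≠ t) :
    ∃ d, d.fst = v ∧ M.IsInOutCorner d := by
  obtain ⟨d, hd, hd'⟩ := h.exists_not_isOut hs
  obtain ⟨e, he, he'⟩ := h.exists_isOut ht
  have hsc := M.rot_sameCycle d e (hd.trans he.symm)
  obtain ⟨z, hz, hz'⟩ := hsc.exists_step (p := IsOut) hd' he'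
  exact ⟨z, hz.induction (p := fun z => z.fst = v) hd fun z _ hz => (M.rot_fst z).trans hz, hz'⟩

theorem exists_isOutInCorner {v : V} (hs : v ≠ s) (ht : v ≠ t) :
    ∃ d, d.fst = v ∧ M.IsOutInCorner d := by
  obtain ⟨d, hd, hd'⟩ := h.exists_isOut ht
  obtain ⟨e, he, he'⟩ := h.exists_not_isOut hs
  have hsc := M.rot_sameCycle d e (hd.trans he.symm)
  obtain ⟨z, hz, hz1, hz2⟩ := hsc.exists_step (p := fun d => ¬ IsOut d) (not_not.2 hd') he'
  exact ⟨z, hz.induction (p := fun z => z.fst = v) hd fun z _ hz => (M.rot_fst z).trans hz,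
    not_not.1 hz1, hz2⟩

/-- Every face has a source corner and a sink corner, and every vertex other than `s` and `t` has
an in-out corner and an out-in corner. By Euler's formula the number of corners, which is twice the
number of edges, leaves no room for a second source corner of a face or a second in-out corner of
a vertex. -/
theorem corners_unique :
    (∀ d e, M.IsSourceCorner d → M.IsSourceCorner e → M.face d = M.face e → d = e) ∧
    ∀ d e, M.IsInOutCorner d → M.IsInOutCorner e → d.fst = e.fst → d = e := by
  classical
  have := Fintype.ofFinite V
  have := Fintype.ofFinite M.Face
  let A := Finset.univ.filter M.IsSourceCorner
  let B := Finset.univ.filter M.IsSinkCorner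
  let C := Finset.univ.filter M.IsInOutCorner
  let D := Finset.univ.filter M.IsOutInCorner
  let W : Finset V := (Finset.univ.erase s).erase t
  have hABCD : A.card + C.card + (D.card + B.card) =
      Fintype.card G.toSimpleGraphInclusive.Dart := by
    rw [← Finset.card_univ, ← Finset.card_filter_add_card_filter_not (s := Finset.univ) IsOut,
      ← Finset.card_filter_add_card_filter_not (s := Finset.univ.filter IsOut)
        (fun d => IsOut (M.rot.symm d)),
      ← Finset.card_filter_add_card_filter_not (s := Finset.univ.filter fun d => ¬ IsOut d)
        (fun d => IsOut (M.rot.symm d))]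
    have eA : A = Finset.univ.filter fun d => IsOut d ∧ IsOut (M.rot.symm d) :=
      Finset.filter_congr fun d _ => and_comm
    have eB : B = Finset.univ.filter fun d => ¬ IsOut d ∧ ¬ IsOut (M.rot.symm d) :=
      Finset.filter_congr fun d _ => and_comm
    have eC : C = Finset.univ.filter fun d => IsOut d ∧ ¬ IsOut (M.rot.symm d) :=
      Finset.filter_congr fun d _ => and_comm
    have eD : D = Finset.univ.filter fun d => ¬ IsOut d ∧ IsOut (M.rot.symm d) :=
      Finset.filter_congr fun d _ => and_comm
    simp only [Finset.filter_filter, eA, eB, eC, eD]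
  have hA : Set.SurjOn M.face A (Finset.univ : Finset M.Face) := fun f _ => by
    obtain ⟨d, hd, hd'⟩ := M.exists_isSourceCorner h.acyclic f
    exact ⟨d, by simpa [A] using hd', hd⟩
  have hB : Set.SurjOn M.face B (Finset.univ : Finset M.Face) := fun f _ => by
    obtain ⟨d, hd, hd'⟩ := M.exists_isSinkCorner h.acyclic f
    exact ⟨d, by simpa [B] using hd', hd⟩
  have hC : Set.SurjOn (fun d : G.toSimpleGraphInclusive.Dart => d.fst) C W := fun v hv => by
    have hv : v ≠ s ∧ v ≠ t := by simpa [W] using hv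
    obtain ⟨d, hd, hd'⟩ := h.exists_isInOutCorner hv.1 hv.2
    exact ⟨d, by simpa [C] using hd', hd⟩
  have hD : Set.SurjOn (fun d : G.toSimpleGraphInclusive.Dart => d.fst) D W := fun v hv => by
    have hv : v ≠ s ∧ v ≠ t := by simpa [W] using hv
    obtain ⟨d, hd, hd'⟩ := h.exists_isOutInCorner hv.1 hv.2
    exact ⟨d, by simpa [D] using hd', hd⟩
  have cA := Finset.card_le_card_of_surjOn _ hA
  have cB := Finset.card_le_card_of_surjOn _ hB
  have cC := Finset.card_le_card_of_surjOn _ hC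
  have cD := Finset.card_le_card_of_surjOn _ hD
  have hst := h.source_ne_sink
  have cW : W.card + 2 = Fintype.card V := by
    have h1 := Finset.card_erase_add_one (Finset.mem_univ s)
    have h2 : W.card + 1 = (Finset.univ.erase s).card :=
      Finset.card_erase_add_one (by simp [hst.symm])
    rw [Finset.card_univ] at h1
    omega
  have euler := M.euler
  rw [Nat.card_eq_fintype_card, Nat.card_eq_fintype_card, Set.ncard_eq_toFinset_card'] at euler
  have hdarts := SimpleGraph.dart_card_eq_twice_card_edges (G := G.toSimpleGraphInclusive)
  rw [SimpleGraph.edgeFinset] at hdarts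
  rw [Finset.card_univ] at cA cB
  constructor
  · intro d e hd he hde
    exact Finset.injOn_of_surjOn_of_card_le M.face (s := A) (t := Finset.univ)
      (fun _ _ => Finset.mem_coe.2 (Finset.mem_univ _)) hA (by rw [Finset.card_univ]; omega)
      (by simpa [A] using hd) (by simpa [A] using he) hde
  · intro d e hd he hde
    refine Finset.injOn_of_surjOn_of_card_le (fun d : G.toSimpleGraphInclusive.Dart => d.fst)
      (s := C) (t := W) (fun d hd => ?_) hC (by omega) (by simpa [C] using hd) (by simpa [C] using he) hde
    have := h.fst_ne_of_isInOutCorner (d := d) (by simpa [C] using hd)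
    simpa [W, and_comm] using this

end IsPlanarSTDigraph

/-! ### Outgoing edges at a vertex -/

section Fan

variable {V : Type*} {G : Digraph V}

/-- The outgoing dart `e` follows the outgoing dart `d` around their common origin, and the face
between them is interior. -/
structure PlaneEmbedding.IsOutStep (M : PlaneEmbedding G.toSimpleGraphInclusive)
    (d e : G.toSimpleGraphInclusive.Dart) : Prop where
  isOut_left : IsOut d
  isOut_right : IsOut e
  rot_eq : M.rot d = e
  face_ne_outer : M.face e ≠ M.outer

theorem PlaneEmbedding.IsOutStep.fst_eq {M : PlaneEmbedding G.toSimpleGraphInclusive}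
    {d e : G.toSimpleGraphInclusive.Dart} (h : M.IsOutStep d e) : e.fst = d.fst := by
  rw [← h.rot_eq, M.rot_fst]

namespace IsPlanarSTDigraph

variable {M : PlaneEmbedding G.toSimpleGraphInclusive} {s t : V} (h : IsPlanarSTDigraph G M s t)
include h

/-- The source corner of the external face is at `s`. -/
theorem exists_isSourceCorner_outer :
    ∃ d, d.fst = s ∧ M.face d = M.outer ∧ M.IsSourceCorner d := by
  obtain ⟨d, hd, hs⟩ := h.source_outer
  exact ⟨d, hs, hd, h.isOut_of_fst_eq_source ((M.rot_symm_fst d).trans hs),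
    h.isOut_of_fst_eq_source hs⟩

variable [Finite V]

/-- Among the outgoing darts at `v` exactly one does not follow another outgoing dart across an
interior face: for `v = s` the dart after the external face, and otherwise the dart after the
incoming ones. -/
theorem existsUnique_first_isOut {v : V} (hv : v ≠ t) :
    ∃! d : G.toSimpleGraphInclusive.Dart,
      (d.fst = v ∧ IsOut d) ∧ ∀ c, ¬ M.IsOutStep c d := by
  obtain ⟨d₀, hd₀, hout, hsrc⟩ := h.exists_isSourceCorner_outer
  have hstep : ∀ d, IsOut d → (∀ c, ¬ M.IsOutStep c d) →
      M.IsInOutCorner d ∨ M.IsSourceCorner d ∧ M.face d = M.outer := by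
    intro d hd hc
    by_cases hd' : IsOut (M.rot.symm d)
    · refine Or.inr ⟨⟨hd', hd⟩, ?_⟩
      by_contra hne
      exact hc _ ⟨hd', hd, M.rot.apply_symm_apply d, hne⟩
    · exact Or.inl ⟨hd', hd⟩
  by_cases hs : v = s
  · subst hs
    refine ⟨d₀, ⟨⟨hd₀, hsrc.2⟩, fun c hc => hc.face_ne_outer hout⟩, ?_⟩
    rintro d ⟨⟨hdv, hd⟩, hc⟩
    rcases hstep d hd hc with hio | ⟨hd', hd''⟩
    · exact absurd hdv (h.fst_ne_of_isInOutCorner hio).1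
    · exact h.corners_unique.1 _ _ hd' hsrc (hd''.trans hout.symm)
  · obtain ⟨e, hev, he⟩ := h.exists_isInOutCorner hs hv
    refine ⟨e, ⟨⟨hev, he.2⟩, fun c hc => he.1 ?_⟩, ?_⟩
    · rw [← hc.rot_eq, Equiv.symm_apply_apply]
      exact hc.isOut_left
    · rintro d ⟨⟨hdv, hd⟩, hc⟩
      rcases hstep d hd hc with hio | ⟨hd', hd''⟩
      · exact h.corners_unique.2 _ _ hio he (hdv.trans hev.symm)
      · have := h.corners_unique.1 _ _ hd' hsrc (hd''.trans hout.symm)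
        exact absurd (hdv.symm.trans (this ▸ hd₀)) hs

/-- The outgoing darts at a vertex form a linear sequence in which consecutive darts bound an
interior face. -/
theorem exists_first_isOut {v : V} (hv : v ≠ t) :
    ∃ e : G.toSimpleGraphInclusive.Dart, (e.fst = v ∧ IsOut e) ∧ (∀ c, ¬ M.IsOutStep c e) ∧
      ∀ d, d.fst = v → IsOut d → ReflTransGen M.IsOutStep e d := by
  obtain ⟨e, ⟨he, hec⟩, huniq⟩ := h.existsUnique_first_isOut hv
  refine ⟨e, he, hec, fun d hdv hd => ?_⟩
  obtain ⟨n, hn⟩ := (M.rot_sameCycle e d (he.1.trans hdv.symm)).exists_nat_pow_eq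
  induction n generalizing d with
  | zero => rw [← hn]; exact .refl
  | succ n ih =>
    rw [pow_succ', Equiv.Perm.mul_apply] at hn
    by_cases hc : ∀ c, ¬ M.IsOutStep c d
    · rw [huniq d ⟨⟨hdv, hd⟩, hc⟩]
    · push Not at hc
      obtain ⟨c, hc⟩ := hc
      refine (ih c (hc.fst_eq.symm.trans hdv) hc.isOut_left ?_).tail hc
      exact M.rot.injective (hn.trans hc.rot_eq.symm)

theorem isOutStep_total {d e : G.toSimpleGraphInclusive.Dart} (hd : IsOut d) (he : IsOut e)
    (hde : d.fst = e.fst) :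
    ReflTransGen M.IsOutStep d e ∨ ReflTransGen M.IsOutStep e d := by
  obtain ⟨e₀, -, -, hreach⟩ :=
    h.exists_first_isOut (v := e.fst) fun ht => h.not_isOut_of_fst_eq_sink ht he
  exact ReflTransGen.total_of_right_unique (fun _ _ _ h1 h2 => h1.rot_eq.symm.trans h2.rot_eq)
    (hreach d hde hd) (hreach e rfl he)

/-- Two outgoing darts `c`, `d` cannot follow each other in both directions: they would be all the
darts at their origin, and neither would be the first outgoing one. -/
theorem ne_of_isOutStep_of_isOutStep {c d e : G.toSimpleGraphInclusive.Dart}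
    (hcd : M.IsOutStep c d) (hde : M.IsOutStep d e) : c ≠ e := by
  rintro rfl
  obtain ⟨e₀, -, hfirst, hreach⟩ :=
    h.exists_first_isOut (v := c.fst) fun ht => h.not_isOut_of_fst_eq_sink ht hcd.isOut_left
  have key : ∀ x, ReflTransGen M.IsOutStep e₀ x → x ≠ c ∧ x ≠ d := by
    intro x hx
    induction hx with
    | refl => exact ⟨fun h => hfirst d (h ▸ hde), fun h => hfirst c (h ▸ hcd)⟩
    | tail _ hyx ih =>
      refine ⟨?_, ?_⟩ <;> rintro rfl
      · exact ih.2 (M.rot.injective (hyx.rot_eq.trans hde.rot_eq.symm))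
      · exact ih.1 (M.rot.injective (hyx.rot_eq.trans hcd.rot_eq.symm))
  exact (key c (hreach c rfl hcd.isOut_left)).1 rfl

end IsPlanarSTDigraph

/-- The triangle between consecutive outgoing darts, seen from its two edges at their origin. -/
theorem PlaneEmbedding.IsOutStep.apex_eq [Finite V] {M : PlaneEmbedding G.toSimpleGraphInclusive}
    (htri : M.IsTriangulated) {d e : G.toSimpleGraphInclusive.Dart} (h : M.IsOutStep d e) :
    M.IsTriangle (M.face e) ∧ M.IsTriangle (M.face d.symm) ∧ M.face d.symm ≠ M.outer ∧
      M.apex e = d.snd ∧ M.apex d.symm = e.snd := by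
  have hf : M.face e = M.face d.symm := by rw [← h.rot_eq, M.face_rot]
  have ht := htri _ h.face_ne_outer
  have hn : M.faceNext d.symm = e := by rw [M.faceNext_symm, h.rot_eq]
  refine ⟨ht, hf ▸ ht, hf ▸ h.face_ne_outer, ?_, ?_⟩
  · have := (hf ▸ ht : M.IsTriangle (M.face d.symm)).snd_faceNext_faceNext
    rw [hn] at this
    exact this
  · rw [RotationSystem.apex, hn]

theorem PlaneEmbedding.IsOutStep.adj_or_adj [Finite V] {M : PlaneEmbedding G.toSimpleGraphInclusive}
    (htri : M.IsTriangulated) {d e : G.toSimpleGraphInclusive.Dart} (h : M.IsOutStep d e) :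
    G.Adj d.snd e.snd ∨ G.Adj e.snd d.snd := by
  have hadj := (M.faceNext e).adj
  rw [M.faceNext_fst] at hadj
  have h4 : (M.faceNext e).snd = d.snd := (h.apex_eq htri).2.2.2.1
  rw [h4] at hadj
  exact hadj.2.symm

namespace IsPlanarSTDigraph

variable {M : PlaneEmbedding G.toSimpleGraphInclusive} {s t : V} (h : IsPlanarSTDigraph G M s t)
include h
variable [Finite V]

/-- If the heads of the two neighbours of an outgoing dart `d` both have an edge to the head of
`d`, then `d` is the median of a facial rhombus. -/
theorem isFacialRhombus_of_isOutStep (htri : M.IsTriangulated)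
    {c d e : G.toSimpleGraphInclusive.Dart} (hcd : M.IsOutStep c d) (hde : M.IsOutStep d e)
    (h1 : G.Adj c.snd d.snd) (h2 : G.Adj e.snd d.snd) :
    IsFacialRhombus G M d.fst d.snd c.snd e.snd := by
  have hne : c.snd ≠ e.snd := fun hce => h.ne_of_isOutStep_of_isOutStep hcd hde
    (SimpleGraph.Dart.ext _ _ (Prod.ext (hcd.fst_eq.symm.trans hde.fst_eq.symm) hce))
  have hG : IsRhombusGraph G d.fst d.snd c.snd e.snd :=
    ⟨hne, hcd.isOut_right, by rw [hcd.fst_eq]; exact hcd.isOut_left, h1,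
      by rw [← hde.fst_eq]; exact hde.isOut_right, h2⟩
  obtain ⟨ht, -, -, ha, -⟩ := hcd.apex_eq htri
  obtain ⟨-, ht', ho', -, hb⟩ := hde.apex_eq htri
  have hrh := isRhombus_of_isTriangle hG rfl hcd.face_ne_outer ho' ht ht' ha hb
  have hrh' := isRhombus_of_isTriangle (d := d.symm) (a := e.snd) (b := c.snd)
    ⟨hne.symm, hG.median, hG.u_b, hG.b_v, hG.u_a, hG.a_v⟩ d.edge_symm ho' hcd.face_ne_outer
    ht' ht hb ha
  refine ⟨hG, ⟨d, rfl, hcd.face_ne_outer, ho', ht, ht', ?_, ?_⟩,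
    hrh.not_reflTransGen h, hrh'.not_reflTransGen h⟩
  · rw [ht.faceVerts_eq, ha]
  · rw [ht'.faceVerts_eq, hb]
    exact Set.insert_comm _ _ _

/-- Without facial rhombi, some out-neighbour of `v` reaches all the others. Along the sequence of
outgoing darts at `v`, heads of consecutive darts are adjacent. Starting from a head without
in-neighbour among the heads, the first edge in either direction points away from it, and so do all
later ones, since two edges pointing to the same head would give a facial rhombus. -/
theorem exists_adj_forall_adj_reflTransGen (htri : M.IsTriangulated)
    (hno : ¬ ∃ u v a b : V, IsFacialRhombus G M u v a b) {v : V} (hv : v ≠ t) :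
    ∃ w, G.Adj v w ∧ ∀ x, G.Adj v x → ReflTransGen G.Adj w x := by
  obtain ⟨w, hvw, hw⟩ := (Digraph.wellFounded_transGen h.acyclic).has_min {w | G.Adj v w} (by
    have := mt (h.sink v).1 hv
    push Not at this
    exact this)
  have adj := @Digraph.toSimpleGraphInclusive_adj_of_adj _ _ h.acyclic
  have hmin : ∀ c : G.toSimpleGraphInclusive.Dart, IsOut c → c.fst = v → ¬ G.Adj c.snd w :=
    fun c hc hcv hcw => hw c.snd (by rw [← hcv]; exact hc) (.single hcw)
  refine ⟨w, hvw, fun x hvx => ?_⟩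
  let d : G.toSimpleGraphInclusive.Dart := ⟨(v, w), adj hvw⟩
  let e : G.toSimpleGraphInclusive.Dart := ⟨(v, x), adj hvx⟩
  rcases h.isOutStep_total (d := d) (e := e) hvw hvx rfl with hde | hed
  · have key : ReflTransGen (fun c c' => M.IsOutStep c c' ∧ G.Adj c.snd c'.snd) d e ∧
        e.fst = v := by
      generalize e = e at hde
      induction hde with
      | refl => exact ⟨.refl, rfl⟩
      | @tail c c' _ hcc ih =>
        refine ⟨ih.1.tail ⟨hcc, ?_⟩, hcc.fst_eq.trans ih.2⟩
        refine (hcc.adj_or_adj htri).resolve_right fun hadj => ?_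
        rcases ih.1.cases_tail with rfl | ⟨b, -, hbc, hbc'⟩
        · exact hmin c' hcc.isOut_right (hcc.fst_eq.trans ih.2) hadj
        · exact hno ⟨_, _, _, _, h.isFacialRhombus_of_isOutStep htri hbc hcc hbc' hadj⟩
    exact key.1.lift (fun d => d.snd) fun _ _ h => h.2
  · have key : ReflTransGen (fun c c' => M.IsOutStep c' c ∧ G.Adj c.snd c'.snd) d e ∧
        e.fst = v := by
      generalize e = e at hed
      induction hed using ReflTransGen.head_induction_on with
      | refl => exact ⟨.refl, rfl⟩
      | @head c' c hcc _ ih =>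
        refine ⟨ih.1.tail ⟨hcc, ?_⟩, hcc.fst_eq.symm.trans ih.2⟩
        refine (hcc.adj_or_adj htri).resolve_left fun hadj => ?_
        rcases ih.1.cases_tail with rfl | ⟨b, -, hbc, hbc'⟩
        · exact hmin c' hcc.isOut_left (hcc.fst_eq.symm.trans ih.2) hadj
        · exact hno ⟨_, _, _, _, h.isFacialRhombus_of_isOutStep htri hcc hbc hadj hbc'⟩
    exact key.1.lift (fun d => d.snd) fun _ _ h => h.2

end IsPlanarSTDigraph

end Fan

theorem theorem1 {V : Type*} [Finite V] (G : Digraph V)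
    (M : PlaneEmbedding G.toSimpleGraphInclusive) (s t : V)
    (hst : IsPlanarSTDigraph G M s t) (htri : M.IsTriangulated) :
    (HasHamiltonianPath G ↔ ¬ ∃ u v a b : V, IsRhombus G M u v a b) ∧
    (HasHamiltonianPath G ↔ ¬ ∃ u v a b : V, IsFacialRhombus G M u v a b) := by
  have h12 : HasHamiltonianPath G → ¬ ∃ u v a b : V, IsRhombus G M u v a b := by
    rintro hham ⟨u, v, a, b, hR⟩
    have hR' : IsRhombus G M u v b a := by
      obtain ⟨⟨hne, h1, h2, h3, h4, h5⟩, S, hout, hS, hmed⟩ := hR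
      exact ⟨⟨hne.symm, h1, h4, h5, h2, h3⟩, S, hout, fun d => (hS d).trans (by tauto), hmed⟩
    rcases hham.reflTransGen_total a b with h | h
    exacts [hR.not_reflTransGen hst h, hR'.not_reflTransGen hst h]
  have h23 : (¬ ∃ u v a b : V, IsRhombus G M u v a b) →
      ¬ ∃ u v a b : V, IsFacialRhombus G M u v a b :=
    fun hno ⟨u, v, a, b, hF⟩ => hno ⟨u, v, a, b, hF.isRhombus hst⟩
  have h31 : (¬ ∃ u v a b : V, IsFacialRhombus G M u v a b) → HasHamiltonianPath G :=
    fun hno => hasHamiltonianPath_of_forall_exists hst.acyclic hst.reflTransGen_source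
      ((hst.sink t).2 rfl) fun _ hv => hst.exists_adj_forall_adj_reflTransGen htri hno hv
  exact ⟨⟨h12, fun hno => h31 (h23 hno)⟩, ⟨fun hham => h23 (h12 hham), h31⟩⟩
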